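/- **Theorem 6.1 ($\psi$-log-Sobolev inequality).** Let $E$ be a smooth ($C^\infty$) $n$-dimensional manifold (for instance an open subset of $\mathbb{R}^n$) with its Borel $\sigma$-algebra, $\mu$ a probability measure on $E$ and $\psi : E \to \mathbb{R}^n$ a smooth diffeomorphism. For smooth $f : E \to \mathbb{R}$ define the $\psi$-gradient $\nabla_\psi f(x) := (D\psi(x))^{-T}\,\nabla f(x) \in \mathbb{R}^n$, that is, the vector with $\langle \nabla_\psi f(x), w\rangle = Df(x)\big(D\psi(x)^{-1}w\big)$ for all $w \in \mathbb{R}^n$ (when $E$ is open in $\mathbb{R}^n$, the inverse transpose of the Jacobian matrix of $\psi$ applied to the usual gradient). For a measure $\nu$ and a $\nu$-integrable function $g > 0$ let $$\operatorname{Ent}_\nu(g) := \int g \log g \, d\nu - \int g\, d\nu \cdot \log \int g \, d\nu \in (-\infty, +\infty].$$ 1. If $\psi_*\mu$ is the standard Gaussian measure on $\mathbb{R}^n$, then for every smooth $\mu$-integrable $f : E \to (0,\infty)$ $$\operatorname{Ent}_\mu(f) \le \frac12 \int_E \frac{\|\nabla_\psi f\|^2}{f}\, d\mu .$$ 2. Let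 $\rho > 0$. If $\psi_*\mu$ satisfies the log-Sobolev inequality with constant $\rho$, i.e. $\operatorname{Ent}_{\psi_*\mu}(g) \le \frac{1}{2\rho}\int_{\mathbb{R}^n} \frac{\|\nabla g\|^2}{g}\, d(\psi_*\mu)$ for every smooth $\psi_*\mu$-integrable $g : \mathbb{R}^n \to (0,\infty)$, then $\mu$ satisfies the $\psi$-log-Sobolev inequality with the same constant, i.e. $\operatorname{Ent}_\mu(f) \le \frac{1}{2\rho}\int_E \frac{\|\nabla_\psi f\|^2}{f}\, d\mu$ for every smooth $\mu$-integrable $f : E \to (0,\infty)$. All inequalities are in $(-\infty,+\infty]$: if the right-hand side is finite, then so is the left-hand side. -/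

import Mathlib

open MeasureTheory ProbabilityTheory
open scoped Manifold ContDiff Gradient

noncomputable section

/-- The entropy `Ent_μ(f) = ∫ f log f dμ - (∫ f dμ) log (∫ f dμ)`. It is only used for `f` such that
`f` and `f log f` are integrable. -/
def entropy {X : Type*} [MeasurableSpace X] (μ : Measure X) (f : X → ℝ) : ℝ :=
  ∫ x, f x * Real.log (f x) ∂μ - (∫ x, f x ∂μ) * Real.log (∫ x, f x ∂μ)

/-- The `ψ`-gradient `∇_ψ f(x) = (Dψ(x))^{-T} ∇f(x)` of `f : E → ℝ` with respect to a diffeomorphism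
`ψ : E → ℝⁿ`: the vector of `ℝⁿ` such that `⟪∇_ψ f(x), w⟫ = Df(x) (Dψ(x)⁻¹ w)` for all `w`.
(Here `Dψ(x) : T_x E → ℝⁿ` is invertible. If `E` is an open subset of `ℝⁿ`, then `Dψ(x)` is the
Jacobian matrix, `Df(x) = ∇f(x)ᵀ`, and the vector is the inverse transpose of the Jacobian applied
to the usual gradient.) -/
def psiGradient {n : ℕ} {E : Type*} [TopologicalSpace E]
    [ChartedSpace (EuclideanSpace ℝ (Fin n)) E]
    (ψ : E ≃ₘ^∞⟮𝓡 n, 𝓡 n⟯ EuclideanSpace ℝ (Fin n)) (f : E → ℝ) (x : E) :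
    EuclideanSpace ℝ (Fin n) :=
  let Df : TangentSpace (𝓡 n) x →L[ℝ] ℝ := mfderiv (𝓡 n) 𝓘(ℝ, ℝ) f x
  let Dψ : TangentSpace (𝓡 n) x →L[ℝ] EuclideanSpace ℝ (Fin n) := mfderiv (𝓡 n) (𝓡 n) ψ x
  (InnerProductSpace.toDual ℝ (EuclideanSpace ℝ (Fin n))).symm (Df ∘L Dψ.inverse)

/-- The measure `ν` on `ℝⁿ` satisfies the log-Sobolev inequality with constant `ρ`:
`Ent_ν(g) ≤ (1 / (2ρ)) ∫ ‖∇g‖² / g dν` for all smooth `ν`-integrable `g > 0`.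
Both sides may take the value `+∞`: if the right-hand side is infinite there is nothing to show,
and if it is finite then so is the left-hand side (that is, `g log g` is integrable; its negative
part always is). -/
def LogSobolev {n : ℕ} (ν : Measure (EuclideanSpace ℝ (Fin n))) (ρ : ℝ) : Prop :=
  ∀ g : EuclideanSpace ℝ (Fin n) → ℝ, ContDiff ℝ ∞ g → (∀ y, 0 < g y) → Integrable g ν →
    Integrable (fun y => ‖∇ g y‖ ^ 2 / g y) ν →
    Integrable (fun y => g y * Real.log (g y)) ν ∧
      entropy ν g ≤ 1 / (2 * ρ) * ∫ y, ‖∇ g y‖ ^ 2 / g y ∂ν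

/-- The measure `μ` on `E` satisfies the `ψ`-log-Sobolev inequality with constant `ρ`:
`Ent_μ(f) ≤ (1 / (2ρ)) ∫ ‖∇_ψ f‖² / f dμ` for all smooth `μ`-integrable `f > 0`, where both sides
may take the value `+∞`, as above. -/
def PsiLogSobolev {n : ℕ} {E : Type*} [TopologicalSpace E]
    [ChartedSpace (EuclideanSpace ℝ (Fin n)) E] [MeasurableSpace E] (μ : Measure E)
    (ψ : E ≃ₘ^∞⟮𝓡 n, 𝓡 n⟯ EuclideanSpace ℝ (Fin n)) (ρ : ℝ) : Prop :=
  ∀ f : E → ℝ, ContMDiff (𝓡 n) 𝓘(ℝ, ℝ) ∞ f → (∀ x, 0 < f x) → Integrable f μ →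
    Integrable (fun x => ‖psiGradient ψ f x‖ ^ 2 / f x) μ →
    Integrable (fun x => f x * Real.log (f x)) μ ∧
      entropy μ f ≤ 1 / (2 * ρ) * ∫ x, ‖psiGradient ψ f x‖ ^ 2 / f x ∂μ

end

open MeasureTheory ProbabilityTheory
open scoped Manifold ContDiff Gradient

/-! Write `g = f ∘ ψ⁻¹`. The chain rule gives `∇_ψ f = ∇ g ∘ ψ`, so changing variables along `ψ`
turns the inequality for `μ` into the one for `ψ_*μ` with the same constant
(`LogSobolev.psiLogSobolev`). This is the second claim; the first then reduces to the Gaussian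
log-Sobolev inequality `logSobolev_stdGaussian`.

In dimension one the Gaussian inequality comes from mass transport. On an interval, let `T` be the
monotone map carrying `f w` to the Gaussian density `w`. Taking logarithms in `f w = T' · w ∘ T`,
using `log T' ≤ T' - 1` and completing a square bounds the entropy density by half the Fisher
information density plus the derivative of `(T - id) w f`. That derivative integrates to zero
because `T` fixes the endpoints (`interval_logSobolev_normalized`). Exhausting the line gives
`entropy_gaussianReal_le`.

Subadditivity of entropy (`entropy_prod_le`) and induction on `n` pass to product measures. Up to
this point functions take values in a compact subinterval of `(0, ∞)`; the truncation `sqrtTrunc`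
does not increase the Fisher information, and Fatou's lemma (`entropy_le_of_tendsto`) yields both
the integrability of `g log g` and the bound. -/

/-! ### Mass transport and the Gaussian inequality on an interval -/

/-- The monotone rearrangement of an interval transporting the density `p` to the density `q`. -/
lemma exists_monotone_transport {p q : ℝ → ℝ} (hp : Continuous p) (hq : Continuous q)
    (hp0 : ∀ x, 0 < p x) (hq0 : ∀ x, 0 < q x) {a b : ℝ} (hab : a ≤ b)
    (h : ∫ x in a..b, p x = ∫ x in a..b, q x) :
    ∃ T : ℝ → ℝ, T a = a ∧ T b = b ∧
      ∀ x ∈ Set.Icc a b, HasDerivAt T (p x / q (T x)) x := by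
  -- Extending `q` from `[a, b]` by its endpoint values gives a density bounded below by some `m >
  -- 0`. Its primitive `G` then grows at least linearly and is a bijection of `ℝ`, so `T = G⁻¹ ∘ F`
  -- is defined globally.
  set q' : ℝ → ℝ := Set.IccExtend hab (fun x => q x)
  have hq'c : Continuous q' := (hq.comp continuous_subtype_val).Icc_extend'
  have hq'eq : ∀ x ∈ Set.Icc a b, q' x = q x := fun x hx => Set.IccExtend_of_mem hab _ hx
  have hq'0 : ∀ x, 0 < q' x := fun x => hq0 _
  obtain ⟨m, hm0, hm⟩ : ∃ m : ℝ, 0 < m ∧ ∀ x, m ≤ q' x := by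
    obtain ⟨z, hz, hmin⟩ := isCompact_Icc.exists_isMinOn (Set.nonempty_Icc.2 hab) hq.continuousOn
    exact ⟨q z, hq0 z, fun x => hmin (Set.projIcc a b hab x).2⟩
  have hderiv : ∀ {r : ℝ → ℝ}, Continuous r → ∀ x, HasDerivAt (fun y => ∫ t in a..y, r t) (r x) x :=
    fun hr x => hr.integral_hasStrictDerivAt a x |>.hasDerivAt
  set G : ℝ → ℝ := fun y => ∫ t in a..y, q' t
  have hGd : ∀ x, HasDerivAt G (q' x) x := hderiv hq'c
  have hGmono : StrictMono G := strictMono_of_deriv_pos fun x => by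
    rw [(hGd x).deriv]; exact hq'0 x
  have hGc : Continuous G := continuous_iff_continuousAt.2 fun x => (hGd x).continuousAt
  have hGlin : Monotone fun x => G x - m * x := by
    refine monotone_of_deriv_nonneg (fun x => ((hGd x).sub
      ((hasDerivAt_id x).const_mul m)).differentiableAt) fun x => ?_
    have := ((hGd x).sub ((hasDerivAt_id x).const_mul m)).deriv
    simp only [id, Pi.sub_def] at this
    rw [this]; linarith [hm x]
  have hsurj : Function.Surjective G := by
    refine hGc.surjective ?_ ?_
    · refine Filter.tendsto_atTop_mono' _ (f₁ := fun x => m * x + (G 0)) ?_ ?_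
      · filter_upwards [Filter.eventually_ge_atTop 0] with x hx
        have := hGlin hx
        simp only at this; linarith
      · exact Filter.tendsto_atTop_add_const_right _ _ (Filter.tendsto_id.const_mul_atTop hm0)
    · refine Filter.tendsto_atBot_mono' _ (f₁ := fun x => m * x + (G 0)) ?_ ?_
      · filter_upwards [Filter.eventually_le_atBot 0] with x hx
        have := hGlin hx
        simp only at this; linarith
      · exact Filter.tendsto_atBot_add_const_right _ _ (Filter.tendsto_id.const_mul_atBot hm0)
  let e : ℝ ≃ₜ ℝ := (StrictMono.orderIsoOfSurjective G hGmono hsurj).toHomeomorph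
  set F : ℝ → ℝ := fun y => ∫ t in a..y, p t
  have hFd : ∀ x, HasDerivAt F (p x) x := hderiv hp
  have hFmono : StrictMono F := strictMono_of_deriv_pos fun x => by
    rw [(hFd x).deriv]; exact hp0 x
  have hinv : ∀ y, G (e.symm y) = y := fun y => e.apply_symm_apply y
  have hsd : ∀ y, HasDerivAt e.symm (q' (e.symm y))⁻¹ y := fun y =>
    HasDerivAt.of_local_left_inverse e.symm.continuous.continuousAt (hGd _) (hq'0 _).ne'
      (Filter.Eventually.of_forall hinv)
  have hTa : e.symm (F a) = a := by
    apply hGmono.injective; rw [hinv]; simp [F, G]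
  have hTb : e.symm (F b) = b := by
    apply hGmono.injective; rw [hinv]
    simp only [F, G]; rw [h]
    refine intervalIntegral.integral_congr fun x hx => ?_
    rw [Set.uIcc_of_le hab] at hx
    exact (hq'eq x hx).symm
  have hTm : Monotone fun x => e.symm (F x) := fun x y hxy => by
    rw [← hGmono.le_iff_le, hinv, hinv]; exact hFmono.monotone hxy
  refine ⟨fun x => e.symm (F x), hTa, hTb, fun x hx => ?_⟩
  -- `T` is monotone and fixes the endpoints, hence preserves `[a, b]`, where `q' = q`.
  have hmem : e.symm (F x) ∈ Set.Icc a b := by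
    constructor
    · rw [← hTa]; exact hTm hx.1
    · rw [← hTb]; exact hTm hx.2
  have := (hsd (F x)).comp x (hFd x)
  rw [hq'eq _ hmem] at this
  exact this.congr_deriv (inv_mul_eq_div _ _)

lemma continuous_gaussianPDFReal (m : ℝ) (v : NNReal) : Continuous (gaussianPDFReal m v) := by
  unfold gaussianPDFReal; fun_prop

lemma hasDerivAt_gaussianPDFReal (x : ℝ) :
    HasDerivAt (gaussianPDFReal 0 1) (-x * gaussianPDFReal 0 1 x) x := by
  have h : HasDerivAt (fun x : ℝ => -(x - 0) ^ 2 / (2 * ((1 : NNReal) : ℝ))) (-x) x := by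
    exact (((((hasDerivAt_id x).sub_const 0).pow 2).neg).div_const
      (2 * ((1 : NNReal) : ℝ))).congr_deriv (by simp; ring)
  exact (h.exp.const_mul (√(2 * Real.pi * (1 : NNReal)))⁻¹).congr_deriv
    (by simp only [gaussianPDFReal]; ring)

/-- The pointwise inequality behind the transport proof of the log-Sobolev inequality: here `y` is
the image of `x` under the transport map, with derivative `t`. -/
lemma mul_log_mul_gaussianPDFReal_le {s d t x y : ℝ} (hs : 0 < s)
    (ht : t = s * gaussianPDFReal 0 1 x / gaussianPDFReal 0 1 y) :
    s * Real.log s * gaussianPDFReal 0 1 x ≤ 1 / 2 * (d ^ 2 / s * gaussianPDFReal 0 1 x) +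
      ((t - 1) * (gaussianPDFReal 0 1 x * s) +
        (y - x) * (-x * gaussianPDFReal 0 1 x * s + gaussianPDFReal 0 1 x * d)) := by
  have hw : ∀ z, 0 < gaussianPDFReal 0 1 z := fun z => gaussianPDFReal_pos 0 1 z one_ne_zero
  have hquot : gaussianPDFReal 0 1 x / gaussianPDFReal 0 1 y = Real.exp ((y ^ 2 - x ^ 2) / 2) := by
    rw [div_eq_iff (hw y).ne']
    simp only [gaussianPDFReal_def]
    rw [mul_left_comm, ← Real.exp_add]
    congr 2
    simp; ring
  have ht0 : 0 < t := by rw [ht]; have := hw x; have := hw y; positivity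
  have hlog : Real.log s = Real.log t - (y ^ 2 - x ^ 2) / 2 := by
    rw [ht, mul_div_assoc, hquot, Real.log_mul hs.ne' (Real.exp_ne_zero _), Real.log_exp]; ring
  have hlogt := Real.log_le_sub_one_of_pos ht0
  have key : s * Real.log s ≤ 1 / 2 * (d ^ 2 / s) + ((t - 1) * s + (y - x) * (-x * s + d)) := by
    have h1 : s * Real.log s ≤ s * (t - 1 - (y ^ 2 - x ^ 2) / 2) := by
      gcongr; rw [hlog]; linarith
    -- After `log t ≤ t - 1`, the gap left between the two sides is exactly this square.
    have h2 : 0 ≤ (d + (y - x) * s) ^ 2 / (2 * s) := by positivity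
    have h3 : (d + (y - x) * s) ^ 2 / (2 * s) =
      1 / 2 * (d ^ 2 / s) + ((t - 1) * s + (y - x) * (-x * s + d)) -
        s * (t - 1 - (y ^ 2 - x ^ 2) / 2) := by
      field_simp; ring
    linarith
  have := mul_le_mul_of_nonneg_right key (hw x).le
  linarith [this]

/-- The log-Sobolev inequality for the Gaussian restricted to a symmetric interval, for normalized
functions. -/
lemma interval_logSobolev_normalized {f f' : ℝ → ℝ} (hf : ∀ x, HasDerivAt f (f' x) x)
    (hf' : Continuous f') (hf0 : ∀ x, 0 < f x) {a b : ℝ} (hab : a ≤ b)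
    (h : ∫ x in a..b, f x * gaussianPDFReal 0 1 x = ∫ x in a..b, gaussianPDFReal 0 1 x) :
    ∫ x in a..b, f x * Real.log (f x) * gaussianPDFReal 0 1 x ≤
      1 / 2 * ∫ x in a..b, f' x ^ 2 / f x * gaussianPDFReal 0 1 x := by
  have hw := continuous_gaussianPDFReal 0 1
  have hw0 : ∀ z, 0 < gaussianPDFReal 0 1 z := fun z => gaussianPDFReal_pos 0 1 z one_ne_zero
  have hfc : Continuous f := continuous_iff_continuousAt.2 fun x => (hf x).continuousAt
  obtain ⟨T, hTa, hTb, hT⟩ := exists_monotone_transport (hfc.mul hw) hw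
    (fun x => mul_pos (hf0 x) (hw0 x)) hw0 hab h
  -- The remainder term of the pointwise inequality at `s = f x`, `d = f' x`, `y = T x`; it is the
  -- derivative of `(T - id) w f`.
  set D : ℝ → ℝ := fun x => (f x * gaussianPDFReal 0 1 x / gaussianPDFReal 0 1 (T x) - 1) *
      (gaussianPDFReal 0 1 x * f x) + (T x - x) * (-x * gaussianPDFReal 0 1 x * f x +
        gaussianPDFReal 0 1 x * f' x) with hD
  have hderiv : ∀ x ∈ Set.uIcc a b,
      HasDerivAt (fun x => (T x - x) * (gaussianPDFReal 0 1 x * f x)) (D x) x := fun x hx => by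
    rw [Set.uIcc_of_le hab] at hx
    exact ((hT x hx).sub (hasDerivAt_id x)).mul ((hasDerivAt_gaussianPDFReal x).mul (hf x))
  have hTc : ContinuousOn T (Set.uIcc a b) := fun x hx => by
    rw [Set.uIcc_of_le hab] at hx
    exact (hT x hx).continuousAt.continuousWithinAt
  have hDi : IntervalIntegrable D volume a b := by
    apply ContinuousOn.intervalIntegrable
    have : ContinuousOn (fun x => gaussianPDFReal 0 1 (T x)) (Set.uIcc a b) :=
      hw.comp_continuousOn hTc
    have h1 : ContinuousOn (fun x => f x * gaussianPDFReal 0 1 x / gaussianPDFReal 0 1 (T x))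
      (Set.uIcc a b) := (hfc.mul hw).continuousOn.div this fun x _ => (hw0 _).ne'
    fun_prop
  have hzero : ∫ x in a..b, D x = 0 := by
    rw [intervalIntegral.integral_eq_sub_of_hasDerivAt hderiv hDi, hTa, hTb]; simp
  have hi1 : IntervalIntegrable (fun x => f x * Real.log (f x) * gaussianPDFReal 0 1 x)
      volume a b := by
    apply Continuous.intervalIntegrable
    exact (hfc.mul (hfc.log fun x => (hf0 x).ne')).mul hw
  have hi2 : IntervalIntegrable (fun x => f' x ^ 2 / f x * gaussianPDFReal 0 1 x)
      volume a b := by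
    apply Continuous.intervalIntegrable
    exact ((hf'.pow 2).div hfc fun x => (hf0 x).ne').mul hw
  calc _ ≤ ∫ x in a..b, (1 / 2 * (f' x ^ 2 / f x * gaussianPDFReal 0 1 x) + D x) :=
        intervalIntegral.integral_mono_on hab hi1 ((hi2.const_mul _).add hDi) fun x _ =>
          mul_log_mul_gaussianPDFReal_le (hf0 x) rfl
    _ = _ := by
        rw [intervalIntegral.integral_add (hi2.const_mul _) hDi, hzero,
          intervalIntegral.integral_const_mul, add_zero]

/-- The log-Sobolev inequality for the Gaussian restricted to an interval. -/
lemma interval_logSobolev {f f' : ℝ → ℝ} (hf : ∀ x, HasDerivAt f (f' x) x)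
    (hf' : Continuous f') (hf0 : ∀ x, 0 < f x) {a b : ℝ} (hab : a < b) :
    (∫ x in a..b, f x * Real.log (f x) * gaussianPDFReal 0 1 x) -
      (∫ x in a..b, f x * gaussianPDFReal 0 1 x) * Real.log
        ((∫ x in a..b, f x * gaussianPDFReal 0 1 x) / ∫ x in a..b, gaussianPDFReal 0 1 x) ≤
      1 / 2 * ∫ x in a..b, f' x ^ 2 / f x * gaussianPDFReal 0 1 x := by
  have hw := continuous_gaussianPDFReal 0 1
  have hw0 : ∀ z, 0 < gaussianPDFReal 0 1 z := fun z => gaussianPDFReal_pos 0 1 z one_ne_zero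
  have hfc : Continuous f := continuous_iff_continuousAt.2 fun x => (hf x).continuousAt
  have hI : 0 < ∫ x in a..b, f x * gaussianPDFReal 0 1 x :=
    intervalIntegral.intervalIntegral_pos_of_pos ((hfc.mul hw).intervalIntegrable _ _)
      (fun x => mul_pos (hf0 x) (hw0 x)) hab
  have hm : 0 < ∫ x in a..b, gaussianPDFReal 0 1 x :=
    intervalIntegral.intervalIntegral_pos_of_pos (hw.intervalIntegrable _ _) hw0 hab
  set I := ∫ x in a..b, f x * gaussianPDFReal 0 1 x with hI'
  set m := ∫ x in a..b, gaussianPDFReal 0 1 x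
  -- The mean of `f` under the normalized restriction of the Gaussian. Both sides of the inequality
  -- are homogeneous of degree one in `f`, so it suffices to treat `f / c`.
  set c := I / m with hc'
  have hc : 0 < c := div_pos hI hm
  have key := interval_logSobolev_normalized (f := fun x => f x / c) (f' := fun x => f' x / c)
    (fun x => (hf x).div_const c) (hf'.div_const c) (fun x => div_pos (hf0 x) hc) hab.le (by
      have : ∀ x, f x / c * gaussianPDFReal 0 1 x = f x * gaussianPDFReal 0 1 x / c :=
        fun x => by ring
      simp only [this, intervalIntegral.integral_div]
      rw [← hI', hc']
      field_simp
      rfl)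
  have h1 : ∀ x, f x / c * Real.log (f x / c) * gaussianPDFReal 0 1 x =
      c⁻¹ * (f x * Real.log (f x) * gaussianPDFReal 0 1 x -
        f x * gaussianPDFReal 0 1 x * Real.log c) := fun x => by
    rw [Real.log_div (hf0 x).ne' hc.ne']; ring
  have h2 : ∀ x, (f' x / c) ^ 2 / (f x / c) * gaussianPDFReal 0 1 x =
      c⁻¹ * (f' x ^ 2 / f x * gaussianPDFReal 0 1 x) := fun x => by
    have := (hf0 x).ne'
    field_simp
  simp only [h1, h2, intervalIntegral.integral_const_mul] at key
  rw [intervalIntegral.integral_sub, intervalIntegral.integral_mul_const, ← hI',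
    mul_left_comm] at key
  · exact le_of_mul_le_mul_left key (inv_pos.2 hc)
  · exact ((hfc.mul (hfc.log fun x => (hf0 x).ne')).mul hw).intervalIntegrable _ _
  · exact ((hfc.mul hw).mul_const _).intervalIntegrable _ _

/-! ### From intervals to the line, for bounded functions -/

lemma tendsto_intervalIntegral_gaussianReal {g : ℝ → ℝ} (hg : Integrable g (gaussianReal 0 1)) :
    Filter.Tendsto (fun R : ℝ => ∫ x in (-R)..R, g x * gaussianPDFReal 0 1 x) Filter.atTop
      (nhds (∫ x, g x ∂gaussianReal 0 1)) := by
  rw [integral_gaussianReal_eq_integral_smul one_ne_zero]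
  rw [gaussianReal_of_var_ne_zero 0 one_ne_zero, integrable_withDensity_iff_integrable_smul'
    (measurable_gaussianPDF _ _) (Filter.Eventually.of_forall fun _ => gaussianPDF_lt_top)] at hg
  simp only [toReal_gaussianPDF, smul_eq_mul] at hg ⊢
  simp only [mul_comm (gaussianPDFReal _ _ _)] at hg ⊢
  exact intervalIntegral_tendsto_integral hg Filter.tendsto_neg_atTop_atBot Filter.tendsto_id

/-- A measurable function with values in a compact interval is integrable. -/
lemma integrable_of_mem_Icc {X : Type*} [MeasurableSpace X] {μ : Measure X} [IsFiniteMeasure μ]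
    {f : X → ℝ} (hf : Measurable f) {a b : ℝ} (hab : ∀ x, f x ∈ Set.Icc a b) : Integrable f μ :=
  Integrable.of_mem_Icc a b hf.aemeasurable (Filter.Eventually.of_forall hab)

/-- Both bounds come from `1 - 1/t ≤ log t ≤ t - 1`. The lower bound `-1` does not depend on `a` or
`b`; this uniformity is reused when applying Fatou's lemma. -/
lemma mul_log_mem_Icc {a b t : ℝ} (ha : 0 < a) (ht : t ∈ Set.Icc a b) :
    t * Real.log t ∈ Set.Icc (-1) (b * b) := by
  have ht0 : 0 < t := ha.trans_le ht.1
  constructor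
  · have := Real.one_sub_inv_le_log_of_pos ht0
    have h2 := mul_le_mul_of_nonneg_left this ht0.le
    rw [mul_sub, mul_inv_cancel₀ ht0.ne'] at h2
    linarith
  · have := Real.log_le_sub_one_of_pos ht0
    nlinarith [ht.2]

lemma integrable_mul_log_of_mem_Icc {X : Type*} [MeasurableSpace X] {μ : Measure X}
    [IsFiniteMeasure μ] {f : X → ℝ} (hf : Measurable f) {a b : ℝ} (ha : 0 < a)
    (hab : ∀ x, f x ∈ Set.Icc a b) : Integrable (fun x => f x * Real.log (f x)) μ :=
  integrable_of_mem_Icc (hf.mul hf.log) fun x => mul_log_mem_Icc ha (hab x)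

/-- The log-Sobolev inequality for the one-dimensional Gaussian and bounded functions. -/
lemma entropy_gaussianReal_le {f f' : ℝ → ℝ} (hf : ∀ x, HasDerivAt f (f' x) x)
    (hf' : Continuous f') {a b : ℝ} (ha : 0 < a) (hab : ∀ x, f x ∈ Set.Icc a b) :
    ENNReal.ofReal (entropy (gaussianReal 0 1) f) ≤
      2⁻¹ * ∫⁻ x, ENNReal.ofReal (f' x ^ 2 / f x) ∂gaussianReal 0 1 := by
  have hf0 : ∀ x, 0 < f x := fun x => ha.trans_le (hab x).1
  have hfc : Continuous f := continuous_iff_continuousAt.2 fun x => (hf x).continuousAt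
  have hqc : Continuous fun x => f' x ^ 2 / f x := (hf'.pow 2).div hfc fun x => (hf0 x).ne'
  have hq0 : ∀ x, 0 ≤ f' x ^ 2 / f x := fun x => div_nonneg (sq_nonneg _) (hf0 x).le
  by_cases htop : ∫⁻ x, ENNReal.ofReal (f' x ^ 2 / f x) ∂gaussianReal 0 1 = ⊤
  · rw [htop, ENNReal.mul_top (by simp)]; exact le_top
  have hq : Integrable (fun x => f' x ^ 2 / f x) (gaussianReal 0 1) := by
    refine ⟨hqc.aestronglyMeasurable, ?_⟩
    rw [hasFiniteIntegral_iff_ofReal (Filter.Eventually.of_forall hq0)]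
    exact lt_top_iff_ne_top.2 htop
  have hfi : Integrable f (gaussianReal 0 1) := integrable_of_mem_Icc hfc.measurable hab
  have hc : 0 < ∫ x, f x ∂gaussianReal 0 1 := by
    have := integral_mono (integrable_const a) hfi fun x => (hab x).1
    simp only [integral_const, probReal_univ, one_smul] at this
    exact ha.trans_le this
  have t1 := tendsto_intervalIntegral_gaussianReal hfi
  have t2 := tendsto_intervalIntegral_gaussianReal
    (integrable_mul_log_of_mem_Icc (μ := gaussianReal 0 1) hfc.measurable ha hab)
  have t3 := tendsto_intervalIntegral_gaussianReal hq
  have t4 := tendsto_intervalIntegral_gaussianReal (integrable_const (1 : ℝ))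
  simp only [one_mul, integral_const, probReal_univ, smul_eq_mul, mul_one] at t4
  -- The Gaussian mass of `[-R, R]` tends to `1`, so the normalization inside the logarithm
  -- disappears in the limit.
  have t5 := t1.div t4 one_ne_zero
  rw [div_one] at t5
  have hlim := le_of_tendsto_of_tendsto (t2.sub (t1.mul (t5.log hc.ne'))) (t3.const_mul (1 / 2)) (by
    filter_upwards [Filter.eventually_gt_atTop 0] with R hR
    exact interval_logSobolev hf hf' hf0 (neg_lt_self hR))
  rw [← ofReal_integral_eq_lintegral_ofReal hq (Filter.Eventually.of_forall hq0)]
  refine (ENNReal.ofReal_le_ofReal hlim).trans_eq ?_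
  rw [ENNReal.ofReal_mul (by norm_num), one_div, ENNReal.ofReal_inv_of_pos two_pos]
  simp

/-! ### Variational bound and subadditivity of the entropy -/

lemma ofReal_integral_le_lintegral {X : Type*} [MeasurableSpace X] {μ : Measure X} {f : X → ℝ}
    (hf : Integrable f μ) : ENNReal.ofReal (∫ x, f x ∂μ) ≤ ∫⁻ x, ENNReal.ofReal (f x) ∂μ := by
  rw [integral_eq_lintegral_pos_part_sub_lintegral_neg_part hf]
  exact (ENNReal.ofReal_le_ofReal (sub_le_self _ ENNReal.toReal_nonneg)).trans
    ENNReal.ofReal_toReal_le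

lemma integral_mem_Icc {X : Type*} [MeasurableSpace X] {μ : Measure X}
    [IsProbabilityMeasure μ] {f : X → ℝ} (hf : Measurable f) {a b : ℝ}
    (hab : ∀ x, f x ∈ Set.Icc a b) : ∫ x, f x ∂μ ∈ Set.Icc a b := by
  have hi : Integrable f μ := integrable_of_mem_Icc hf hab
  have h1 := integral_mono (integrable_const a) hi fun x => (hab x).1
  have h2 := integral_mono hi (integrable_const b) fun x => (hab x).2
  simp only [integral_const, probReal_univ, one_smul] at h1 h2
  exact ⟨h1, h2⟩

lemma log_mem_Icc {a b t : ℝ} (ha : 0 < a) (ht : t ∈ Set.Icc a b) :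
    Real.log t ∈ Set.Icc (Real.log a) (Real.log b) :=
  ⟨Real.log_le_log ha ht.1, Real.log_le_log (ha.trans_le ht.1) ht.2⟩

/-- The easy half of the variational formula for the entropy. -/
lemma integral_mul_log_le_entropy {X : Type*} [MeasurableSpace X] {μ : Measure X}
    [IsProbabilityMeasure μ] {f p : X → ℝ} (hf : Measurable f) (hp : Measurable p) {a b a' b' : ℝ}
    (ha : 0 < a) (ha' : 0 < a') (hab : ∀ x, f x ∈ Set.Icc a b) (hab' : ∀ x, p x ∈ Set.Icc a' b')
    (h : ∫ x, p x ∂μ = 1) : ∫ x, f x * Real.log (p x) ∂μ ≤ entropy μ f := by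
  have hfi : Integrable f μ := integrable_of_mem_Icc hf hab
  have hpi : Integrable p μ := integrable_of_mem_Icc hp hab'
  have hfl := integrable_mul_log_of_mem_Icc (μ := μ) hf ha hab
  have hlp : Integrable (fun x => Real.log (p x)) μ :=
    integrable_of_mem_Icc hp.log fun x => log_mem_Icc ha' (hab' x)
  have hfp : Integrable (fun x => f x * Real.log (p x)) μ :=
    hlp.bdd_mul hf.aestronglyMeasurable (c := b) (Filter.Eventually.of_forall fun x => by
      rw [Real.norm_of_nonneg (ha.le.trans (hab x).1)]; exact (hab x).2)
  set c := ∫ x, f x ∂μ with hc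
  have hc0 : 0 < c := ha.trans_le (integral_mem_Icc hf hab).1
  have hpt : ∀ x, f x * Real.log (p x) ≤
      f x * Real.log (f x) - f x * Real.log c + (p x * c - f x) := fun x => by
    have hfx := ha.trans_le (hab x).1
    have hpx := ha'.trans_le (hab' x).1
    -- The correction `p c - f` produced by this bound has integral zero, since `∫ p = 1` and `∫ f =
    -- c`.
    have := Real.log_le_sub_one_of_pos (show 0 < p x * c / f x by positivity)
    rw [Real.log_div (by positivity) hfx.ne', Real.log_mul hpx.ne' hc0.ne'] at this
    have h2 := mul_le_mul_of_nonneg_left this hfx.le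
    have h3 : f x * (p x * c / f x - 1) = p x * c - f x := by field_simp
    linarith
  have hi1 : Integrable (fun x => f x * Real.log (f x) - f x * Real.log c) μ :=
    hfl.sub (hfi.mul_const (Real.log c))
  have hi2 : Integrable (fun x => p x * c - f x) μ := (hpi.mul_const c).sub hfi
  refine (integral_mono hfp (hi1.add hi2) hpt).trans_eq ?_
  rw [integral_add' hi1 hi2, integral_sub hfl (hfi.mul_const _), integral_sub (hpi.mul_const _) hfi,
    integral_mul_const, integral_mul_const, h, ← hc, entropy]
  ring

/-- Subadditivity of the entropy of bounded functions with respect to product measures. -/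
lemma entropy_prod_le {X Y : Type*} [MeasurableSpace X] [MeasurableSpace Y] {μ : Measure X}
    {ν : Measure Y} [IsProbabilityMeasure μ] [IsProbabilityMeasure ν] {f : X × Y → ℝ}
    (hf : Measurable f) {a b : ℝ} (ha : 0 < a) (hab : ∀ z, f z ∈ Set.Icc a b) :
    ENNReal.ofReal (entropy (μ.prod ν) f) ≤
      ∫⁻ y, ENNReal.ofReal (entropy μ fun x => f (x, y)) ∂ν +
        ∫⁻ x, ENNReal.ofReal (entropy ν fun y => f (x, y)) ∂μ := by
  have hfx : ∀ y, Measurable fun x => f (x, y) := fun y => hf.comp measurable_prodMk_right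
  have hfy : ∀ x, Measurable fun y => f (x, y) := fun x => hf.comp measurable_prodMk_left
  have hfi : Integrable f (μ.prod ν) := integrable_of_mem_Icc hf hab
  have hfl := integrable_mul_log_of_mem_Icc (μ := μ.prod ν) hf ha hab
  set g : Y → ℝ := fun y => ∫ x, f (x, y) ∂μ with hg
  have hgm : Measurable g := hf.stronglyMeasurable.integral_prod_left'.measurable
  have hgab : ∀ y, g y ∈ Set.Icc a b := fun y => integral_mem_Icc (hfx y) fun x => hab _
  have hgi : Integrable g ν := integrable_of_mem_Icc hgm hgab
  have hgl := integrable_mul_log_of_mem_Icc (μ := ν) hgm ha hgab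
  set h : X → ℝ := fun x => ∫ y, f (x, y) ∂ν
  have hhm : Measurable h := hf.stronglyMeasurable.integral_prod_right'.measurable
  have hhab : ∀ x, h x ∈ Set.Icc a b := fun x => integral_mem_Icc (hfy x) fun y => hab _
  have hhl := integrable_mul_log_of_mem_Icc (μ := μ) hhm ha hhab
  have hI1 : Integrable (fun y => entropy μ fun x => f (x, y)) ν := hfl.integral_prod_right.sub hgl
  have hI2 : Integrable (fun x => entropy ν fun y => f (x, y)) μ := hfl.integral_prod_left.sub hhl
  set c := ∫ y, g y ∂ν with hc
  have hcab : c ∈ Set.Icc a b := integral_mem_Icc hgm hgab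
  have hc0 : 0 < c := ha.trans_le hcab.1
  have hcf : ∫ z, f z ∂μ.prod ν = c := integral_prod_symm f hfi
  have hpm : Measurable fun y => g y / c := hgm.div_const c
  have hpab : ∀ y, g y / c ∈ Set.Icc (a / c) (b / c) := fun y =>
    ⟨div_le_div_of_nonneg_right (hgab y).1 hc0.le, div_le_div_of_nonneg_right (hgab y).2 hc0.le⟩
  have hac : 0 < a / c := div_pos ha hc0
  have hflog : Integrable (fun z : X × Y => f z * Real.log (g z.2 / c)) (μ.prod ν) := by
    refine Integrable.bdd_mul (c := b) (integrable_of_mem_Icc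
      (hpm.log.comp measurable_snd) fun z => log_mem_Icc hac (hpab z.2))
      hf.aestronglyMeasurable (Filter.Eventually.of_forall fun x => ?_)
    rw [Real.norm_of_nonneg (ha.le.trans (hab x).1)]; exact (hab x).2
  -- Chain rule: the entropy of `f` is the mean entropy of its slices in `x` plus the entropy of the
  -- marginal `g`.
  have e1 : entropy (μ.prod ν) f =
      ∫ y, (entropy μ fun x => f (x, y)) ∂ν + (∫ y, g y * Real.log (g y) ∂ν - c * Real.log c) := by
    simp only [entropy]
    rw [integral_sub hfl.integral_prod_right hgl, hcf, integral_prod_symm _ hfl]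
    ring
  have e2 : ∫ y, g y * Real.log (g y) ∂ν - c * Real.log c =
      ∫ z, f z * Real.log (g z.2 / c) ∂μ.prod ν := by
    rw [integral_prod_symm _ hflog]
    simp only [integral_mul_const]
    rw [hc, ← integral_mul_const, ← integral_sub hgl (hgi.mul_const _), ← hc]
    refine integral_congr_ae (Filter.Eventually.of_forall fun y => ?_)
    simp only
    rw [Real.log_div (ha.trans_le (hgab y).1).ne' hc0.ne']
    ring
  -- For each fixed `x`, the marginal density `g / c` is a competitor in the variational formula for
  -- the entropy of `f (x, ·)`.
  have e3 : ∫ z, f z * Real.log (g z.2 / c) ∂μ.prod ν ≤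
      ∫ x, (entropy ν fun y => f (x, y)) ∂μ := by
    rw [integral_prod _ hflog]
    refine integral_mono hflog.integral_prod_left hI2 fun x => ?_
    refine integral_mul_log_le_entropy (hfy x) hpm ha hac (fun y => hab _) hpab ?_
    rw [integral_div, ← hc, div_self hc0.ne']
  calc ENNReal.ofReal (entropy (μ.prod ν) f)
      ≤ ENNReal.ofReal (∫ y, (entropy μ fun x => f (x, y)) ∂ν +
          ∫ x, (entropy ν fun y => f (x, y)) ∂μ) := by
        apply ENNReal.ofReal_le_ofReal; rw [e1, e2]; gcongr
    _ ≤ _ := ENNReal.ofReal_add_le.trans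
        (add_le_add (ofReal_integral_le_lintegral hI1) (ofReal_integral_le_lintegral hI2))

/-! ### Tensorization to the standard Gaussian on `ℝⁿ` -/

lemma entropy_map_equiv {X Y : Type*} [MeasurableSpace X] [MeasurableSpace Y] {μ : Measure X}
    {ν : Measure Y} (e : X ≃ᵐ Y) (he : MeasurePreserving e μ ν) (f : Y → ℝ) :
    entropy μ (fun x => f (e x)) = entropy ν f := by
  simp only [entropy]
  rw [he.integral_comp' (g := f), he.integral_comp' (g := fun y => f y * Real.log (f y))]

lemma hasDerivAt_insertNth_left {n : ℕ} (x : ℝ) (y : Fin n → ℝ) :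
    HasDerivAt (fun t : ℝ => (Fin.insertNth 0 t y : Fin (n + 1) → ℝ)) (Pi.single 0 1) x := by
  rw [hasDerivAt_pi]
  intro i
  refine Fin.cases ?_ (fun j => ?_) i
  · simpa using hasDerivAt_id' x
  · simpa using hasDerivAt_const x (y j)

lemma hasFDerivAt_insertNth_right {n : ℕ} (x : ℝ) (y : Fin n → ℝ) :
    HasFDerivAt (fun z : Fin n → ℝ => (Fin.insertNth 0 x z : Fin (n + 1) → ℝ))
      (ContinuousLinearMap.pi (Fin.cons 0 fun j : Fin n =>
        ContinuousLinearMap.proj (R := ℝ) (φ := fun _ : Fin n => ℝ) j)) y := by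
  rw [hasFDerivAt_pi]
  intro i
  refine Fin.cases ?_ (fun j => ?_) i
  · simpa using hasFDerivAt_const x y
  · simpa using hasFDerivAt_apply j y

/-- The log-Sobolev inequality for the Gaussian product measure and bounded functions. -/
lemma entropy_pi_gaussianReal_le (n : ℕ) {F : (Fin n → ℝ) → ℝ} (hF : ContDiff ℝ 1 F) {a b : ℝ}
    (ha : 0 < a) (hab : ∀ x, F x ∈ Set.Icc a b) :
    ENNReal.ofReal (entropy (Measure.pi fun _ : Fin n => gaussianReal 0 1) F) ≤
      2⁻¹ * ∫⁻ x, ∑ i, ENNReal.ofReal ((fderiv ℝ F x (Pi.single i 1)) ^ 2 / F x)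
        ∂(Measure.pi fun _ : Fin n => gaussianReal 0 1) := by
  induction n with
  | zero =>
    have : F = fun _ => F 0 := funext fun x => congrArg F (Subsingleton.elim _ _)
    rw [this]
    simp [entropy]
  | succ n ih =>
    set P := Measure.pi fun _ : Fin n => gaussianReal 0 1
    have he := measurePreserving_piFinSuccAbove (fun _ : Fin (n + 1) => gaussianReal 0 1) 0
    set e := MeasurableEquiv.piFinSuccAbove (fun _ : Fin (n + 1) => ℝ) 0
    set F' : ℝ × (Fin n → ℝ) → ℝ := fun z => F (Fin.insertNth 0 z.1 z.2) with hF'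
    have hes : ∀ z, e.symm z = Fin.insertNth 0 z.1 z.2 := fun z => rfl
    have hF'e : ∀ x, F' (e x) = F x := fun x => by
      simp only [F']; rw [← hes, e.symm_apply_apply]
    have hd : Differentiable ℝ F := hF.differentiable one_ne_zero
    have hF'c : Continuous F' := by
      have h0 : Continuous fun z : ℝ × (Fin n → ℝ) => (Fin.insertNth 0 z.1 z.2 : Fin (n + 1) → ℝ) :=
        Continuous.finInsertNth (A := fun _ => ℝ) 0 continuous_fst continuous_snd
      exact hF.continuous.comp h0
    have hD : ∀ i, Continuous fun x => fderiv ℝ F x (Pi.single i 1) := fun i =>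
      (hF.continuous_fderiv one_ne_zero).clm_apply continuous_const
    set D : Fin (n + 1) → ℝ × (Fin n → ℝ) → ENNReal := fun i z =>
      ENNReal.ofReal ((fderiv ℝ F (Fin.insertNth 0 z.1 z.2) (Pi.single i 1)) ^ 2 / F' z)
    have hDm : ∀ i, Measurable (D i) := fun i => by
      have h0 : Measurable fun z : ℝ × (Fin n → ℝ) => (Fin.insertNth 0 z.1 z.2 : Fin (n + 1) → ℝ) :=
        e.symm.measurable
      exact ((((hD i).measurable.comp h0).pow_const 2).div hF'c.measurable).ennreal_ofReal
    have hL : entropy (Measure.pi fun _ : Fin (n + 1) => gaussianReal 0 1) F =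
        entropy ((gaussianReal 0 1).prod P) F' := by
      rw [← entropy_map_equiv e he F']; simp only [hF'e]
    have hR : ∫⁻ x, ∑ i, ENNReal.ofReal ((fderiv ℝ F x (Pi.single i 1)) ^ 2 / F x)
        ∂(Measure.pi fun _ : Fin (n + 1) => gaussianReal 0 1) =
        ∫⁻ z, ∑ i, D i z ∂((gaussianReal 0 1).prod P) := by
      rw [← he.lintegral_comp_emb e.measurableEmbedding]
      refine lintegral_congr fun x => Finset.sum_congr rfl fun i _ => ?_
      simp only [D]
      rw [hF'e, ← hes, e.symm_apply_apply]
    rw [hL, hR]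
    simp only [Fin.sum_univ_succ]
    rw [lintegral_add_left (hDm 0), mul_add]
    -- The slices in the first coordinate are handled by the one-dimensional inequality, those in
    -- the remaining coordinates by the induction hypothesis.
    refine (entropy_prod_le hF'c.measurable ha fun z => hab _).trans (add_le_add ?_ ?_)
    · rw [lintegral_prod_symm' _ (hDm 0), ← lintegral_const_mul _ (hDm 0).lintegral_prod_left']
      refine lintegral_mono fun y => ?_
      refine entropy_gaussianReal_le (f' := fun x => fderiv ℝ F (Fin.insertNth 0 x y)
        (Pi.single 0 1)) (fun x => ?_) ?_ ha fun x => hab _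
      · exact (hd _).hasFDerivAt.comp_hasDerivAt x (hasDerivAt_insertNth_left x y)
      · exact (hD 0).comp (Continuous.finInsertNth (A := fun _ => ℝ) 0 continuous_id continuous_const)
    · have hS : Measurable fun z => ∑ i : Fin n, D i.succ z :=
        Finset.measurable_sum _ fun i _ => hDm _
      rw [lintegral_prod _ hS.aemeasurable, ← lintegral_const_mul _ hS.lintegral_prod_right']
      refine lintegral_mono fun x => ?_
      have hcd : ContDiff ℝ 1 fun y : Fin n → ℝ => F' (x, y) := by
        refine hF.comp (contDiff_pi.2 fun i => ?_)
        refine Fin.cases ?_ (fun j => ?_) i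
        · simpa using contDiff_const
        · simpa using contDiff_apply ℝ ℝ j
      refine (ih hcd fun y => hab _).trans_eq ?_
      congr 1
      refine lintegral_congr fun y => Finset.sum_congr rfl fun i _ => ?_
      have hfd := ((hd _).hasFDerivAt.comp y (hasFDerivAt_insertNth_right x y)).fderiv
      have hv : (ContinuousLinearMap.pi (Fin.cons 0 fun j => ContinuousLinearMap.proj j) :
          (Fin n → ℝ) →L[ℝ] Fin (n + 1) → ℝ) (Pi.single i 1) = Pi.single i.succ 1 := by
        ext k
        refine Fin.cases ?_ (fun j => ?_) k
        · simp
        · simp [Pi.single_apply]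
      simp only [D]
      rw [show (fun y : Fin n → ℝ => F' (x, y)) = F ∘ fun z => Fin.insertNth 0 x z from rfl, hfd,
        ContinuousLinearMap.comp_apply, hv]

/-- The log-Sobolev inequality for the standard Gaussian and bounded functions. -/
lemma entropy_stdGaussian_le {n : ℕ} {G : EuclideanSpace ℝ (Fin n) → ℝ} (hG : ContDiff ℝ 1 G)
    {a b : ℝ} (ha : 0 < a) (hab : ∀ x, G x ∈ Set.Icc a b) :
    ENNReal.ofReal (entropy (stdGaussian (EuclideanSpace ℝ (Fin n))) G) ≤
      2⁻¹ * ∫⁻ x, ENNReal.ofReal (‖∇ G x‖ ^ 2 / G x) ∂stdGaussian (EuclideanSpace ℝ (Fin n)) := by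
  have hG0 : ∀ x, 0 < G x := fun x => ha.trans_le (hab x).1
  let e := MeasurableEquiv.toLp 2 (Fin n → ℝ)
  let L : (Fin n → ℝ) →L[ℝ] EuclideanSpace ℝ (Fin n) :=
    (EuclideanSpace.equiv (Fin n) ℝ).symm.toContinuousLinearMap
  have heL : ∀ x, e x = L x := fun x => rfl
  have he : MeasurePreserving e (Measure.pi fun _ : Fin n => gaussianReal 0 1)
      (stdGaussian (EuclideanSpace ℝ (Fin n))) := ⟨e.measurable, map_pi_eq_stdGaussian⟩
  have key := entropy_pi_gaussianReal_le n (F := fun x => G (L x)) (hG.comp L.contDiff) ha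
    fun x => hab _
  rw [← entropy_map_equiv e he, ← he.lintegral_comp_emb e.measurableEmbedding]
  refine key.trans_eq ?_
  congr 1
  refine lintegral_congr fun x => ?_
  have hd : ∀ i, fderiv ℝ (fun x => G (L x)) x (Pi.single i 1) = ∇ G (L x) i := fun i => by
    have h1 := ((hG.differentiable one_ne_zero (L x)).hasFDerivAt.comp x L.hasFDerivAt).fderiv
    have h2 : L (Pi.single i 1) = EuclideanSpace.single i 1 := rfl
    rw [show (fun x => G (L x)) = G ∘ L from rfl, h1, ContinuousLinearMap.comp_apply, h2,
      ← inner_gradient_left, EuclideanSpace.inner_single_right]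
    simp
  rw [← ENNReal.ofReal_sum_of_nonneg fun i _ => div_nonneg (sq_nonneg _) (hG0 _).le,
    ← Finset.sum_div, heL, EuclideanSpace.real_norm_sq_eq]
  simp only [hd]

/-! ### Truncation and the unbounded case -/

/-- A smooth bounded approximation of the identity of `(0, ∞)`, whose square root is a contraction
as a function of the square root. -/
noncomputable def sqrtTrunc (ε t : ℝ) : ℝ := (ε + √t / (1 + ε * √t)) ^ 2

lemma sqrtTrunc_mem_Icc {ε : ℝ} (hε : 0 < ε) (t : ℝ) :
    sqrtTrunc ε t ∈ Set.Icc (ε ^ 2) ((ε + 1 / ε) ^ 2) := by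
  have hs := Real.sqrt_nonneg t
  have h1 : √t / (1 + ε * √t) ≤ 1 / ε := by
    rw [div_le_div_iff₀ (by positivity) hε]; linarith
  unfold sqrtTrunc
  constructor <;> gcongr
  linarith [show 0 ≤ √t / (1 + ε * √t) by positivity]

/-- The bound is uniform in `ε`, as dominated convergence of the means requires. -/
lemma sqrtTrunc_le {ε t : ℝ} (hε : 0 < ε) (hε1 : ε ≤ 1) (ht : 0 ≤ t) :
    sqrtTrunc ε t ≤ 2 + 2 * t := by
  have hs := Real.sqrt_nonneg t
  have h1 : √t / (1 + ε * √t) ≤ √t := div_le_self hs (by nlinarith)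
  calc sqrtTrunc ε t ≤ (1 + √t) ^ 2 := by unfold sqrtTrunc; gcongr
    _ ≤ 2 + 2 * t := by nlinarith [sq_nonneg (1 - √t), Real.sq_sqrt ht]

lemma tendsto_sqrtTrunc {ι : Type*} {l : Filter ι} {ε : ι → ℝ} (hε : Filter.Tendsto ε l (nhds 0))
    {t : ℝ} (ht : 0 ≤ t) : Filter.Tendsto (fun k => sqrtTrunc (ε k) t) l (nhds t) := by
  have h : ContinuousAt (fun e : ℝ => sqrtTrunc e t) 0 := by
    unfold sqrtTrunc
    fun_prop (disch := simp)
  have h0 : sqrtTrunc 0 t = t := by simp [sqrtTrunc, Real.sq_sqrt ht]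
  have := h.tendsto.comp hε
  rwa [h0] at this

lemma contDiffAt_sqrtTrunc {ε t : ℝ} (hε : 0 < ε) (ht : 0 < t) :
    ContDiffAt ℝ 1 (sqrtTrunc ε) t := by
  have hs : ContDiffAt ℝ 1 (fun t : ℝ => √t) t := Real.contDiffAt_sqrt ht.ne'
  unfold sqrtTrunc
  exact (contDiffAt_const.add (hs.div (contDiffAt_const.add (contDiffAt_const.mul hs))
    (by have := Real.sqrt_nonneg t; positivity))).pow 2

/-- With `u = √t`, the square root of the truncation is `ε + u / (1 + ε u)`, whose derivative in `u`
is `1 / (1 + ε u)² ≤ 1`. Since `‖∇g‖² / g = 4 ‖∇√g‖²`, composing with the truncation does not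
increase the Fisher information. -/
lemma deriv_sqrtTrunc_sq_div_le {ε t : ℝ} (hε : 0 < ε) (ht : 0 < t) :
    deriv (sqrtTrunc ε) t ^ 2 / sqrtTrunc ε t ≤ 1 / t := by
  have hs : HasDerivAt (fun t : ℝ => √t) (1 / (2 * √t)) t := Real.hasDerivAt_sqrt ht.ne'
  have hs0 : 0 < √t := Real.sqrt_pos.2 ht
  have hne : 1 + ε * √t ≠ 0 := by positivity
  have hd := ((hs.div ((hs.const_mul ε).const_add 1) hne).const_add ε).pow 2
  have hd' : deriv (sqrtTrunc ε) t = (ε + √t / (1 + ε * √t)) * (1 / (√t * (1 + ε * √t) ^ 2)) := by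
    refine (HasDerivAt.deriv (f := sqrtTrunc ε) hd).trans ?_
    have h1 : (1 / (2 * √t) * (1 + ε * √t) - √t * (ε * (1 / (2 * √t)))) / (1 + ε * √t) ^ 2 =
        1 / (√t * (1 + ε * √t) ^ 2) / 2 := by
      field_simp
      ring
    rw [h1]
    simp only [Pi.div_apply]
    push_cast
    ring
  have hv : 0 < ε + √t / (1 + ε * √t) := by positivity
  rw [hd', sqrtTrunc, mul_pow, mul_div_assoc, mul_div_left_comm, div_self (by positivity), mul_one,
    div_pow, one_pow, mul_pow, Real.sq_sqrt ht.le]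
  apply one_div_le_one_div_of_le ht
  have h1 : 1 ≤ 1 + ε * √t := by nlinarith
  exact le_mul_of_one_le_right ht.le (one_le_pow₀ (one_le_pow₀ h1))

/-- Passage to the limit in an upper bound for the entropy. -/
lemma entropy_le_of_tendsto {X : Type*} [MeasurableSpace X] {μ : Measure X}
    [IsProbabilityMeasure μ] {f : X → ℝ} {F : ℕ → X → ℝ} (hf : Measurable f)
    (hF : ∀ k, Measurable (F k)) (hfi : Integrable f μ) (hF0 : ∀ k x, 0 < F k x)
    (hFle : ∀ k x, F k x ≤ 2 + 2 * f x)
    (hlim : ∀ x, Filter.Tendsto (fun k => F k x) Filter.atTop (nhds (f x)))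
    (hFl : ∀ k, Integrable (fun x => F k x * Real.log (F k x)) μ) {C : ℝ}
    (hC : ∀ k, entropy μ (F k) ≤ C) :
    Integrable (fun x => f x * Real.log (f x)) μ ∧ entropy μ f ≤ C := by
  -- Adding `1` makes `t log t` nonnegative, so Fatou's lemma applies on the probability space.
  have hlow : ∀ t : ℝ, 0 ≤ t → 0 ≤ t * Real.log t + 1 := fun t ht => by
    rcases ht.eq_or_lt with rfl | ht
    · simp
    · linarith [(mul_log_mem_Icc ht (Set.left_mem_Icc.2 le_rfl)).1]
  have hf0 : ∀ x, 0 ≤ f x := fun x => ge_of_tendsto' (hlim x) fun k => (hF0 k x).le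
  have hc : Filter.Tendsto (fun k => ∫ x, F k x ∂μ) Filter.atTop (nhds (∫ x, f x ∂μ)) := by
    refine tendsto_integral_of_dominated_convergence (fun x => 2 + 2 * f x)
      (fun k => (hF k).aestronglyMeasurable) ((integrable_const _).add (hfi.const_mul 2))
      (fun k => Filter.Eventually.of_forall fun x => ?_) (Filter.Eventually.of_forall hlim)
    rw [Real.norm_of_nonneg (hF0 k x).le]; exact hFle k x
  have hcl := (Real.continuous_mul_log.tendsto (∫ x, f x ∂μ)).comp hc
  set c := ∫ x, f x ∂μ with hc'
  have hbound : Filter.Tendsto (fun k => C + (∫ x, F k x ∂μ) * Real.log (∫ x, F k x ∂μ) + 1)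
      Filter.atTop (nhds (C + c * Real.log c + 1)) := (hcl.const_add C).add_const 1
  have hFl1 : ∀ k, Integrable (fun x => F k x * Real.log (F k x) + 1) μ :=
    fun k => (hFl k).add (integrable_const _)
  have hk : ∀ k, ∫⁻ x, ENNReal.ofReal (F k x * Real.log (F k x) + 1) ∂μ ≤
      ENNReal.ofReal (C + (∫ x, F k x ∂μ) * Real.log (∫ x, F k x ∂μ) + 1) := fun k => by
    rw [← ofReal_integral_eq_lintegral_ofReal (hFl1 k)
      (Filter.Eventually.of_forall fun x => hlow _ (hF0 k x).le)]
    apply ENNReal.ofReal_le_ofReal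
    rw [integral_add (hFl k) (integrable_const _)]
    have := hC k
    simp only [entropy] at this
    simp only [integral_const, probReal_univ, one_smul]
    linarith
  -- `ENNReal.ofReal` clips negative numbers to `0`; nonnegativity of the limiting bound lets the
  -- final inequality return to `ℝ`.
  have hk0 : 0 ≤ C + c * Real.log c + 1 := by
    refine ge_of_tendsto' hbound fun k => ?_
    have h1 := hC k
    have h2 : 0 ≤ ∫ x, (F k x * Real.log (F k x) + 1) ∂μ :=
      integral_nonneg fun x => hlow _ (hF0 k x).le
    rw [integral_add (hFl k) (integrable_const _)] at h2
    simp only [integral_const, probReal_univ, one_smul] at h2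
    simp only [entropy] at h1
    linarith
  have hfatou : ∫⁻ x, ENNReal.ofReal (f x * Real.log (f x) + 1) ∂μ ≤
      ENNReal.ofReal (C + c * Real.log c + 1) := by
    have hpt : ∀ x, ENNReal.ofReal (f x * Real.log (f x) + 1) =
        Filter.liminf (fun k => ENNReal.ofReal (F k x * Real.log (F k x) + 1)) Filter.atTop :=
      fun x => (Filter.Tendsto.liminf_eq (ENNReal.tendsto_ofReal
        (((Real.continuous_mul_log.tendsto (f x)).comp (hlim x)).add_const 1))).symm
    simp only [hpt]
    refine (lintegral_liminf_le fun k =>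
      (((hF k).mul (hF k).log).add_const 1).ennreal_ofReal).trans ?_
    rw [← (ENNReal.tendsto_ofReal hbound).liminf_eq]
    exact Filter.liminf_le_liminf (Filter.Eventually.of_forall hk)
  have hint : Integrable (fun x => f x * Real.log (f x) + 1) μ := by
    refine ⟨((hf.mul hf.log).add_const 1).aestronglyMeasurable, ?_⟩
    rw [hasFiniteIntegral_iff_ofReal (Filter.Eventually.of_forall fun x => hlow _ (hf0 x))]
    exact hfatou.trans_lt ENNReal.ofReal_lt_top
  have hint' : Integrable (fun x => f x * Real.log (f x)) μ := by
    simpa [Pi.sub_def] using hint.sub (integrable_const (1 : ℝ))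
  refine ⟨hint', ?_⟩
  rw [← ofReal_integral_eq_lintegral_ofReal hint
    (Filter.Eventually.of_forall fun x => hlow _ (hf0 x)), ENNReal.ofReal_le_ofReal_iff hk0,
    integral_add hint' (integrable_const _)] at hfatou
  simp only [integral_const, probReal_univ, one_smul] at hfatou
  rw [entropy, ← hc']
  linarith

/-- The **Gaussian log-Sobolev inequality**. -/
theorem logSobolev_stdGaussian (n : ℕ) :
    LogSobolev (stdGaussian (EuclideanSpace ℝ (Fin n))) 1 := by
  intro g hg hg0 hgi hgrad
  set ε : ℕ → ℝ := fun k => 1 / ((k : ℝ) + 1) with hε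
  have hε0 : ∀ k, 0 < ε k := fun k => by simp only [ε]; positivity
  have hε1 : ∀ k, ε k ≤ 1 := fun k => by
    simp only [ε]; rw [div_le_one (by positivity)]; linarith [(k.cast_nonneg : (0 : ℝ) ≤ k)]
  set F : ℕ → EuclideanSpace ℝ (Fin n) → ℝ := fun k x => sqrtTrunc (ε k) (g x) with hF
  have hg1 : ContDiff ℝ 1 g := hg.of_le (by exact_mod_cast le_top)
  have hFc : ∀ k, ContDiff ℝ 1 (F k) := fun k => contDiff_iff_contDiffAt.2 fun x =>
    (contDiffAt_sqrtTrunc (hε0 k) (hg0 x)).comp x hg1.contDiffAt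
  have hFab : ∀ k x, F k x ∈ Set.Icc (ε k ^ 2) ((ε k + 1 / ε k) ^ 2) :=
    fun k x => sqrtTrunc_mem_Icc (hε0 k) _
  have hF0 : ∀ k x, 0 < F k x := fun k x => (pow_pos (hε0 k) 2).trans_le (hFab k x).1
  have hFgrad : ∀ k x, ‖∇ (F k) x‖ ^ 2 / F k x ≤ ‖∇ g x‖ ^ 2 / g x := fun k x => by
    have hd : HasGradientAt (F k) (deriv (sqrtTrunc (ε k)) (g x) • ∇ g x) x := by
      rw [hasGradientAt_iff_hasFDerivAt, map_smul]
      exact ((contDiffAt_sqrtTrunc (hε0 k) (hg0 x)).differentiableAt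
        one_ne_zero).hasDerivAt.comp_hasFDerivAt x
        (hg1.differentiable one_ne_zero x).hasGradientAt.hasFDerivAt
    rw [hd.gradient, norm_smul, mul_pow, Real.norm_eq_abs, sq_abs, mul_div_right_comm]
    have := mul_le_mul_of_nonneg_right (deriv_sqrtTrunc_sq_div_le (hε0 k) (hg0 x))
      (sq_nonneg ‖∇ g x‖)
    rwa [one_div_mul_eq_div] at this
  refine entropy_le_of_tendsto (F := F) hg1.continuous.measurable
    (fun k => (hFc k).continuous.measurable) hgi hF0
    (fun k x => sqrtTrunc_le (hε0 k) (hε1 k) (hg0 x).le)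
    (fun x => tendsto_sqrtTrunc tendsto_one_div_add_atTop_nhds_zero_nat (hg0 x).le)
    (fun k => integrable_mul_log_of_mem_Icc (hFc k).continuous.measurable (pow_pos (hε0 k) 2)
      (hFab k)) fun k => ?_
  have h1 := entropy_stdGaussian_le (hFc k) (pow_pos (hε0 k) 2) (hFab k)
  have h0 : ∀ x, 0 ≤ ‖∇ g x‖ ^ 2 / g x := fun x => div_nonneg (sq_nonneg _) (hg0 x).le
  have h2 : ENNReal.ofReal (entropy (stdGaussian (EuclideanSpace ℝ (Fin n))) (F k)) ≤
      ENNReal.ofReal (1 / (2 * 1) * ∫ x, ‖∇ g x‖ ^ 2 / g x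
        ∂stdGaussian (EuclideanSpace ℝ (Fin n))) := by
    rw [ENNReal.ofReal_mul (by norm_num), mul_one, one_div, ENNReal.ofReal_inv_of_pos two_pos,
      ENNReal.ofReal_ofNat,
      ofReal_integral_eq_lintegral_ofReal hgrad (Filter.Eventually.of_forall h0)]
    refine h1.trans ?_
    exact mul_le_mul_right (lintegral_mono fun x => ENNReal.ofReal_le_ofReal (hFgrad k x)) _
  exact (ENNReal.ofReal_le_ofReal_iff (mul_nonneg (by norm_num) (integral_nonneg h0))).1 h2

/-! ### Transfer along the diffeomorphism -/

/-- Only topological vector space structure is assumed, so that the cancellation applies directly to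
tangent spaces. -/
lemma comp_comp_inverse_equiv {V W : Type*} [AddCommGroup V] [TopologicalSpace V] [Module ℝ V]
    [AddCommGroup W] [TopologicalSpace W] [Module ℝ W] (D : V ≃L[ℝ] W) (A : W →L[ℝ] ℝ) :
    (A ∘L (D : V →L[ℝ] W)) ∘L (D : V →L[ℝ] W).inverse = A := by
  ext w
  simp

section
variable {n : ℕ} {E : Type*} [TopologicalSpace E] [ChartedSpace (EuclideanSpace ℝ (Fin n)) E]

/-- The `ψ`-gradient of `f` is the gradient of `f ∘ ψ⁻¹` at the image point. -/
lemma psiGradient_eq_gradient [IsManifold (𝓡 n) ∞ E]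
    (ψ : E ≃ₘ^∞⟮𝓡 n, 𝓡 n⟯ EuclideanSpace ℝ (Fin n)) {f : E → ℝ}
    (hf : ContMDiff (𝓡 n) 𝓘(ℝ, ℝ) ∞ f) (x : E) :
    psiGradient ψ f x = ∇ (fun y => f (ψ.symm y)) (ψ x) := by
  have htop : (∞ : WithTop ℕ∞) ≠ 0 := by simp
  let D := ψ.mfderivToContinuousLinearEquiv htop x
  have hD : (mfderiv (𝓡 n) (𝓡 n) ψ x) = D := rfl
  -- Chain rule for `f = (f ∘ ψ⁻¹) ∘ ψ`; composing with `Dψ(x)⁻¹` on the right then leaves the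
  -- derivative of `f ∘ ψ⁻¹`.
  have hchain : mfderiv (𝓡 n) 𝓘(ℝ, ℝ) f x =
      (mfderiv (𝓡 n) 𝓘(ℝ, ℝ) (fun y => f (ψ.symm y)) (ψ x)).comp (mfderiv (𝓡 n) (𝓡 n) ψ x) := by
    have h1 : MDifferentiableAt (𝓡 n) 𝓘(ℝ, ℝ) (fun y => f (ψ.symm y)) (ψ x) :=
      (hf.comp ψ.symm.contMDiff).mdifferentiableAt htop
    have h2 : MDifferentiableAt (𝓡 n) (𝓡 n) ψ x := ψ.contMDiff.mdifferentiableAt htop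
    rw [← mfderiv_comp x h1 h2]
    congr 1
    ext y
    simp
  rw [psiGradient, gradient]
  congr 1
  rw [hchain, ← mfderiv_eq_fderiv, hD]
  exact comp_comp_inverse_equiv (V := TangentSpace (𝓡 n) x) (W := TangentSpace (𝓡 n) (ψ x)) D _

/-- The log-Sobolev inequality is transported by a diffeomorphism. -/
theorem LogSobolev.psiLogSobolev [IsManifold (𝓡 n) ∞ E] [MeasurableSpace E] [BorelSpace E]
    {μ : Measure E} {ψ : E ≃ₘ^∞⟮𝓡 n, 𝓡 n⟯ EuclideanSpace ℝ (Fin n)} {ρ : ℝ}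
    (h : LogSobolev (μ.map ψ) ρ) : PsiLogSobolev μ ψ ρ := by
  intro f hf hf0 hfi hgrad
  -- For a measurable embedding, the change of variables holds for every integrand, in both
  -- directions, with no measurability to check.
  have hψ : MeasurableEmbedding ψ := ψ.toHomeomorph.measurableEmbedding
  set g : EuclideanSpace ℝ (Fin n) → ℝ := fun y => f (ψ.symm y)
  have hg : ContDiff ℝ ∞ g := (hf.comp ψ.symm.contMDiff).contDiff
  have hgf : ∀ x, g (ψ x) = f x := fun x => by simp [g]
  have hpg : ∀ x, psiGradient ψ f x = ∇ g (ψ x) := psiGradient_eq_gradient ψ hf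
  simp only [hpg, ← hgf] at hgrad ⊢
  have hfi' : Integrable (fun x => g (ψ x)) μ := by simpa only [hgf] using hfi
  have key := h g hg (fun y => hf0 _) (hψ.integrable_map_iff.2 hfi') (hψ.integrable_map_iff.2 hgrad)
  refine ⟨hψ.integrable_map_iff.1 key.1, ?_⟩
  have hent : entropy μ f = entropy (μ.map ψ) g := by
    simp only [entropy, hψ.integral_map, hgf]
  rw [hent]
  simpa only [hψ.integral_map] using key.2

end

theorem theorem6p1 {n : ℕ} {E : Type*} [TopologicalSpace E]
    [ChartedSpace (EuclideanSpace ℝ (Fin n)) E] [IsManifold (𝓡 n) ∞ E]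
    [MeasurableSpace E] [BorelSpace E] (μ : Measure E) [IsProbabilityMeasure μ]
    (ψ : E ≃ₘ^∞⟮𝓡 n, 𝓡 n⟯ EuclideanSpace ℝ (Fin n)) :
    (μ.map ψ = stdGaussian (EuclideanSpace ℝ (Fin n)) →
      ∀ f : E → ℝ, ContMDiff (𝓡 n) 𝓘(ℝ, ℝ) ∞ f → (∀ x, 0 < f x) → Integrable f μ →
        Integrable (fun x => ‖psiGradient ψ f x‖ ^ 2 / f x) μ →
        Integrable (fun x => f x * Real.log (f x)) μ ∧
          entropy μ f ≤ 1 / 2 * ∫ x, ‖psiGradient ψ f x‖ ^ 2 / f x ∂μ) ∧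
    (∀ ρ : ℝ, 0 < ρ → LogSobolev (μ.map ψ) ρ → PsiLogSobolev μ ψ ρ) := by
  refine ⟨fun hμ f hf hf0 hfi hgrad => ?_, fun ρ _ h => h.psiLogSobolev⟩
  have h : LogSobolev (μ.map ψ) 1 := hμ ▸ logSobolev_stdGaussian n
  simpa only [mul_one] using h.psiLogSobolev f hf hf0 hfi hgrad
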